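/- Let $G$ be a finitely presented, residually finite group and let $H$ be a finitely generated group; fix finite generating sets $S$ of $G$ and $T$ of $H$. A \emph{filtration} of a group is a decreasing (not necessarily strictly) sequence $(N_i)_{i\in\mathbb{N}}$ of finite-index normal subgroups with $\bigcap_i N_i=\{1\}$. The \emph{box space} $\Box_{(N_i)}G$ is the disjoint union $\bigsqcup_i G/N_i$, in which each $G/N_i$ carries the Cayley graph metric given by the image of $S$, and points of two distinct components are at distance equal to the sum of the diameters of these components (this is a pseudometric: distinct one-point components have distance $0$); $\Box_{(M_i)}H$ is defined in the same way using $T$. Two (pseudo)metric spaces $X,Y$ are \emph{coarsely equivalent} if there are a map $\varphi\colon X\to Y$, (continuous) proper functions $\rho_\pm\colon[0,\infty)\to[0,\infty)$ and a constant $C>0$ such that $\rho_-(d_X(a,b))\le d_Y(\varphi(a),\varphi(b))\le\rho_+(d_X(a,b))$ for all $a,b\in X$, and every point of $Y$ is at distance at most $C$ from some point of $\varphi(X)$. Then the following are equivalent: (1) there exist filtrations $(N_i)$ of $G$ and $(M_i)$ of $H$ such that $\Box_{(N_i)}G$ and $\Box_{(M_i)}H$ are coarsely equivalent; (2) $G$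 and $H$ are commensurable via a normal subgroup, i.e. there are finite-index normal subgroups $K\lhd G$ and $L\lhd H$ with $K\cong L$. -/

import Mathlib

open scoped NNReal

/-- A filtration of a group `G`: a nested (decreasing) sequence of normal finite index subgroups
of `G` with trivial intersection. -/
structure GroupFiltration (G : Type*) [Group G] where
  /-- The `i`-th subgroup. -/
  subgroup : ℕ → Subgroup G
  antitone : Antitone subgroup
  normal : ∀ i, (subgroup i).Normal
  finiteIndex : ∀ i, (subgroup i).FiniteIndex
  iInf_eq_bot : ⨅ i, subgroup i = ⊥

attribute [instance] GroupFiltration.normal GroupFiltration.finiteIndex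

/-- The Cayley graph of the quotient `G ⧸ N` with respect to the image of the set `S`. -/
def quotientCayley {G : Type*} [Group G] (S : Finset G) (N : Subgroup G) [N.Normal] :
    SimpleGraph (G ⧸ N) :=
  SimpleGraph.mulCayley (QuotientGroup.mk' N '' (S : Set G))

/-- If `S` generates `G`, then the Cayley graph of `G ⧸ N` is connected. -/
theorem quotientCayley_connected {G : Type*} [Group G] (S : Finset G)
    (hS : Subgroup.closure (S : Set G) = ⊤) (N : Subgroup G) [N.Normal] :
    (quotientCayley S N).Connected := by
  have step : ∀ s ∈ S, ∀ a : G ⧸ N,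
      (quotientCayley S N).Reachable a (a * QuotientGroup.mk' N s) := by
    intro s hs a
    by_cases h : a = a * QuotientGroup.mk' N s
    · rw [← h]
    · exact SimpleGraph.Adj.reachable
        ((SimpleGraph.mulCayley_adj' _ _ _).2 ⟨h, _, ⟨s, hs, rfl⟩, Or.inl rfl⟩)
  have key : ∀ g : G, ∀ a : G ⧸ N,
      (quotientCayley S N).Reachable a (a * QuotientGroup.mk' N g) := by
    intro g
    have hg : g ∈ Subgroup.closure (S : Set G) := by rw [hS]; exact Subgroup.mem_top g
    induction hg using Subgroup.closure_induction with
    | mem x hx => exact step x hx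
    | one => intro a; rw [map_one, mul_one]
    | mul x y _ _ hx hy =>
      intro a
      rw [map_mul, ← mul_assoc]
      exact (hx a).trans (hy _)
    | inv x _ hx =>
      intro a
      have h := hx (a * QuotientGroup.mk' N x⁻¹)
      rw [mul_assoc, ← map_mul, inv_mul_cancel, map_one, mul_one] at h
      exact h.symm
  refine ⟨fun a b => ?_⟩
  obtain ⟨g, hg⟩ := QuotientGroup.mk'_surjective N (a⁻¹ * b)
  have h := key g a
  rwa [hg, mul_inv_cancel_left] at h

/-- In the Cayley graph of a finite quotient, distances are bounded by the diameter. -/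
theorem quotientCayley_dist_le_diam {G : Type*} [Group G] (S : Finset G)
    (hS : Subgroup.closure (S : Set G) = ⊤) (N : Subgroup G) [N.Normal] [N.FiniteIndex]
    (a b : G ⧸ N) : (quotientCayley S N).dist a b ≤ (quotientCayley S N).diam :=
  SimpleGraph.dist_le_diam
    (SimpleGraph.connected_iff_ediam_ne_top.1 (quotientCayley_connected S hS N))

/-- The underlying set of the box space of `G` with respect to the finite generating set `S` and
the filtration `N`: the disjoint union of the quotients `G ⧸ N i`. -/
structure BoxSpace {G : Type*} [Group G] (S : Finset G) (hS : Subgroup.closure (S : Set G) = ⊤)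
    (N : GroupFiltration G) where
  /-- The index of the component. -/
  index : ℕ
  /-- The point of that component. -/
  point : G ⧸ N.subgroup index

namespace BoxSpace

variable {G : Type*} [Group G] {S : Finset G} {hS : Subgroup.closure (S : Set G) = ⊤}
  {N : GroupFiltration G}

open Classical in
/-- The distance on the box space: the Cayley graph distance inside each component, and the sum of
the diameters of the two components for points of distinct components. -/
noncomputable def natDist (x y : BoxSpace S hS N) : ℕ :=
  if h : x.index = y.index then
    (quotientCayley S (N.subgroup y.index)).dist (h ▸ x.point) y.point
  else
    (quotientCayley S (N.subgroup x.index)).diam + (quotientCayley S (N.subgroup y.index)).diam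

theorem natDist_same (i : ℕ) (a b : G ⧸ N.subgroup i) :
    natDist (⟨i, a⟩ : BoxSpace S hS N) ⟨i, b⟩ = (quotientCayley S (N.subgroup i)).dist a b := by
  simp [natDist]

theorem natDist_of_ne {i j : ℕ} (h : i ≠ j) (a : G ⧸ N.subgroup i) (b : G ⧸ N.subgroup j) :
    natDist (⟨i, a⟩ : BoxSpace S hS N) ⟨j, b⟩ =
      (quotientCayley S (N.subgroup i)).diam + (quotientCayley S (N.subgroup j)).diam := by
  simp [natDist, h]

theorem natDist_self (x : BoxSpace S hS N) : natDist x x = 0 := by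
  obtain ⟨i, a⟩ := x
  rw [natDist_same, SimpleGraph.dist_self]

theorem natDist_comm (x y : BoxSpace S hS N) : natDist x y = natDist y x := by
  obtain ⟨i, a⟩ := x
  obtain ⟨j, b⟩ := y
  by_cases h : i = j
  · subst h
    rw [natDist_same, natDist_same, SimpleGraph.dist_comm]
  · rw [natDist_of_ne h, natDist_of_ne (Ne.symm h), add_comm]

theorem natDist_triangle (x y z : BoxSpace S hS N) :
    natDist x z ≤ natDist x y + natDist y z := by
  obtain ⟨i, a⟩ := x
  obtain ⟨j, b⟩ := y
  obtain ⟨k, c⟩ := z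
  have hd := fun (l : ℕ) (u v : G ⧸ N.subgroup l) =>
    quotientCayley_dist_le_diam S hS (N.subgroup l) u v
  by_cases hij : i = j
  · subst hij
    by_cases hik : i = k
    · subst hik
      rw [natDist_same, natDist_same, natDist_same]
      exact (quotientCayley_connected S hS _).dist_triangle
    · rw [natDist_same, natDist_of_ne hik, natDist_of_ne hik]
      omega
  · by_cases hjk : j = k
    · subst hjk
      rw [natDist_same, natDist_of_ne hij, natDist_of_ne hij]
      omega
    · rw [natDist_of_ne hij, natDist_of_ne hjk]
      by_cases hik : i = k
      · subst hik
        rw [natDist_same]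
        have := hd i a c
        omega
      · rw [natDist_of_ne hik]
        omega

/-- The box space metric. It is only a pseudometric, since two components that are both
one-point spaces have distance zero. -/
noncomputable instance : PseudoMetricSpace (BoxSpace S hS N) where
  dist x y := (natDist x y : ℝ)
  dist_self x := by simp [natDist_self]
  dist_comm x y := by rw [natDist_comm]
  dist_triangle x y z := by exact_mod_cast natDist_triangle x y z

end BoxSpace

/-- A coarse embedding, with control functions that are proper maps from `[0, ∞)` to itself. -/
def IsCoarseEmbedding {X Y : Type*} [PseudoMetricSpace X] [PseudoMetricSpace Y] (φ : X → Y) :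
    Prop :=
  ∃ ρ₁ ρ₂ : ℝ≥0 → ℝ≥0, IsProperMap ρ₁ ∧ IsProperMap ρ₂ ∧
    ∀ a b : X, ρ₁ (nndist a b) ≤ nndist (φ a) (φ b) ∧ nndist (φ a) (φ b) ≤ ρ₂ (nndist a b)

/-- A coarse equivalence: a coarse embedding whose image is `C`-dense for some `C > 0`. -/
def IsCoarseEquivalence {X Y : Type*} [PseudoMetricSpace X] [PseudoMetricSpace Y] (φ : X → Y) :
    Prop :=
  IsCoarseEmbedding φ ∧ ∃ C : ℝ, 0 < C ∧ ∀ y : Y, ∃ x : X, dist (φ x) y ≤ C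

/-- Two spaces are coarsely equivalent if there is a coarse equivalence from one to the other. -/
def CoarselyEquivalent (X Y : Type*) [PseudoMetricSpace X] [PseudoMetricSpace Y] : Prop :=
  ∃ φ : X → Y, IsCoarseEquivalence φ

/-- `G` and `H` are commensurable via a normal subgroup if they have isomorphic finite index
normal subgroups. -/
def CommensurableViaNormal (G H : Type*) [Group G] [Group H] : Prop :=
  ∃ (K : Subgroup G) (L : Subgroup H), K.Normal ∧ K.FiniteIndex ∧ L.Normal ∧ L.FiniteIndex ∧
    Nonempty (K ≃* L)

/-! For infinite groups, a coarse equivalence of box spaces must send each deep component into a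
single deep component, because distinct deep components are far apart. This gives uniformly
controlled maps between arbitrarily deep finite quotients. Along an ultrafilter these maps converge
to a coarse equivalence from `G` to `H`. A finitely presented group is coarsely simply connected
(every non-abelian cocycle given at large scale is a coboundary), and this property is a coarse
invariant, so `H` has it too.

Take one sufficiently deep pair of quotients with kernels `N`, `M` and a controlled map `f`. The
increments of `f` have unique short lifts to `H`. These lifts form a cocycle on `G`, and integrating
it gives `F : G → H` covering `f`. The cocycle is invariant under `N`, so `F` is a homomorphism on
`N`. A coarse inverse of `f` lifts in the same way. The composites of the two lifts cover maps close
to the identity, which forces them to be the identity on the kernels, so `N ≃* M`.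

Conversely, given `e : K ≃* L`, filter both groups by subgroups defined intrinsically from `K` and
`L`. Then `e` matches the two filtrations, and a coset transversal extends `e` to a quasi-isometry
of box spaces. -/

open scoped Pointwise

/-! ### Word metrics and Lipschitz maps -/

/-- The ball of radius `n` around `1` for the word metric defined by the set `S`. -/
def wordBall {P : Type*} [Group P] (S : Set P) (n : ℕ) : Set P :=
  (insert 1 (S ∪ S⁻¹)) ^ n

namespace wordBall

variable {P Q : Type*} [Group P] [Group Q] {S : Set P}

theorem one_mem (n : ℕ) : (1 : P) ∈ wordBall S n :=
  Set.one_mem_pow (Set.mem_insert _ _)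

theorem mono {m n : ℕ} (h : m ≤ n) : wordBall S m ⊆ wordBall S n :=
  Set.pow_subset_pow_right (Set.mem_insert _ _) h

theorem mul_mem {m n : ℕ} {a b : P} (ha : a ∈ wordBall S m) (hb : b ∈ wordBall S n) :
    a * b ∈ wordBall S (m + n) := by
  rw [wordBall, pow_add]
  exact Set.mul_mem_mul ha hb

theorem inv_mem {n : ℕ} {a : P} (ha : a ∈ wordBall S n) : a⁻¹ ∈ wordBall S n := by
  have h : (wordBall S n)⁻¹ = wordBall S n := by
    rw [wordBall, ← inv_pow, Set.inv_insert, Set.union_inv, inv_inv, inv_one, Set.union_comm]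
  rw [← h]
  simpa using ha

theorem inv_mul_comm {n : ℕ} {a b : P} (h : a⁻¹ * b ∈ wordBall S n) :
    b⁻¹ * a ∈ wordBall S n := by
  simpa using inv_mem h

theorem inv_mul_trans {m n : ℕ} {a b c : P} (h : a⁻¹ * b ∈ wordBall S m)
    (h' : b⁻¹ * c ∈ wordBall S n) : a⁻¹ * c ∈ wordBall S (m + n) := by
  have := mul_mem h h'
  rwa [mul_assoc, mul_inv_cancel_left] at this

theorem subset_one {s : P} (hs : s ∈ S) : s ∈ wordBall S 1 := by
  rw [wordBall, pow_one]
  exact Set.mem_insert_of_mem _ (Or.inl hs)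

theorem zero_eq : wordBall S 0 = {1} := by
  rw [wordBall, pow_zero, Set.singleton_one]

theorem finite (hS : S.Finite) (n : ℕ) : (wordBall S n).Finite := by
  induction n with
  | zero => simp [zero_eq]
  | succ n ih =>
    rw [wordBall, pow_succ]
    exact ih.mul ((hS.union hS.inv).insert 1)

theorem exists_mem (hS : Subgroup.closure S = ⊤) (g : P) : ∃ n, g ∈ wordBall S n := by
  have hg : g ∈ Subgroup.closure S := hS ▸ Subgroup.mem_top g
  induction hg using Subgroup.closure_induction with
  | mem x hx => exact ⟨1, subset_one hx⟩
  | one => exact ⟨0, one_mem 0⟩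
  | mul x y _ _ hx hy =>
    obtain ⟨m, hm⟩ := hx
    obtain ⟨n, hn⟩ := hy
    exact ⟨m + n, mul_mem hm hn⟩
  | inv x _ hx =>
    obtain ⟨m, hm⟩ := hx
    exact ⟨m, inv_mem hm⟩

theorem exists_subset (hS : Subgroup.closure S = ⊤) {E : Set P} (hE : E.Finite) :
    ∃ n, E ⊆ wordBall S n := by
  induction E, hE using Set.Finite.induction_on with
  | empty => exact ⟨0, Set.empty_subset _⟩
  | @insert a s _ _ ih =>
    obtain ⟨n, hn⟩ := ih
    obtain ⟨m, hm⟩ := exists_mem hS a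
    exact ⟨max m n, Set.insert_subset (mono (le_max_left _ _) hm)
      (hn.trans (mono (le_max_right _ _)))⟩

theorem image (f : P →* Q) (n : ℕ) : f '' wordBall S n = wordBall (f '' S) n := by
  rw [wordBall, wordBall, Set.image_pow, Set.image_insert_eq, Set.image_union, map_one,
    Set.image_inv]

theorem map_mem (f : P →* Q) {n : ℕ} {a : P} (h : a ∈ wordBall S n) :
    f a ∈ wordBall (f '' S) n :=
  image f n ▸ Set.mem_image_of_mem f h

theorem exists_of_mem_image (f : P →* Q) {n : ℕ} {b : Q} (h : b ∈ wordBall (f '' S) n) :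
    ∃ a ∈ wordBall S n, f a = b := by
  rwa [← image f n] at h

theorem closure_image (hS : Subgroup.closure S = ⊤) {f : P →* Q} (hf : Function.Surjective f) :
    Subgroup.closure (f '' S) = ⊤ := by
  rw [← MonoidHom.map_closure, hS, Subgroup.map_top_of_surjective f hf]

/-- A map that moves by at most `n` along generators is `n`-Lipschitz. -/
theorem lipschitz {T : Set Q} {f : P → Q} {n : ℕ}
    (hf : ∀ x y, x⁻¹ * y ∈ wordBall S 1 → (f x)⁻¹ * f y ∈ wordBall T n) (k : ℕ) {x y : P}
    (h : x⁻¹ * y ∈ wordBall S k) : (f x)⁻¹ * f y ∈ wordBall T (n * k) := by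
  induction k generalizing y with
  | zero =>
    rw [zero_eq, Set.mem_singleton_iff, inv_mul_eq_one] at h
    rw [h, inv_mul_cancel]
    exact one_mem _
  | succ k ih =>
    rw [wordBall, pow_succ] at h
    obtain ⟨a, ha, b, hb, hab⟩ := Set.mem_mul.1 h
    have h1 := ih (y := x * a) (by rwa [inv_mul_cancel_left])
    have h2 := hf (x * a) y (by
      rw [mul_inv_rev, mul_assoc, ← hab, inv_mul_cancel_left, wordBall, pow_one]
      exact hb)
    exact inv_mul_trans h1 h2

/-- It suffices to move by at most `n` along positive generators. -/
theorem lipschitz_one {T : Set Q} {f : P → Q} {n : ℕ}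
    (hf : ∀ x, ∀ s ∈ S, (f x)⁻¹ * f (x * s) ∈ wordBall T n) (x y : P)
    (h : x⁻¹ * y ∈ wordBall S 1) : (f x)⁻¹ * f y ∈ wordBall T n := by
  rw [wordBall, pow_one] at h
  rcases h with h | h | h
  · rw [inv_mul_eq_one] at h
    rw [h, inv_mul_cancel]
    exact one_mem _
  · simpa using hf x _ h
  · have h2 := hf y _ (Set.mem_inv.1 h)
    exact inv_mul_comm (by simpa using h2)

end wordBall

/-- Two maps with the same increments along generators and the same value at `1` agree. -/
theorem eq_of_increments_eq {P A : Type*} [Group P] [Group A] {S : Set P}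
    (hS : Subgroup.closure S = ⊤) {u v : P → A} (h1 : u 1 = v 1)
    (h : ∀ x, ∀ s ∈ S, (u x)⁻¹ * u (x * s) = (v x)⁻¹ * v (x * s)) : u = v := by
  have key : ∀ g : P, ∀ x, (u x)⁻¹ * u (x * g) = (v x)⁻¹ * v (x * g) := by
    intro g
    have hg : g ∈ Subgroup.closure S := hS ▸ Subgroup.mem_top g
    induction hg using Subgroup.closure_induction with
    | mem s hs => exact fun x => h x s hs
    | one => simp
    | mul a b _ _ ha hb =>
      intro x
      have := congrArg₂ (· * ·) (ha x) (hb (x * a))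
      simpa [mul_assoc] using this
    | inv a _ ha =>
      intro x
      have := congrArg (·⁻¹) (ha (x * a⁻¹))
      simpa using this
  funext g
  have := key g 1
  rwa [one_mul, h1, mul_right_inj] at this

/-- Closed balls of the Cayley graph metric are translates of word balls. -/
theorem mulCayley_dist_le_iff {P : Type*} [Group P] {S : Set P}
    (hc : (SimpleGraph.mulCayley S).Connected) {a b : P} {n : ℕ} :
    (SimpleGraph.mulCayley S).dist a b ≤ n ↔ a⁻¹ * b ∈ wordBall S n := by
  have adj : ∀ x y, x⁻¹ * y ∈ wordBall S 1 ↔ x = y ∨ (SimpleGraph.mulCayley S).Adj x y := by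
    intro x y
    by_cases hxy : x = y
    · simp [hxy, wordBall.one_mem]
    · rw [SimpleGraph.mulCayley_adj', wordBall, pow_one, Set.mem_insert_iff, inv_mul_eq_one,
        Set.mem_union, Set.mem_inv]
      simp only [hxy, false_or, ne_eq, not_false_eq_true, true_and]
      constructor
      · rintro (h | h)
        · exact ⟨_, h, Or.inl (by simp)⟩
        · exact ⟨_, h, Or.inr (by simp)⟩
      · rintro ⟨g, hg, rfl | rfl⟩
        · exact Or.inl (by simpa)
        · exact Or.inr (by simpa)
  constructor
  · intro h
    obtain ⟨p, hp⟩ := hc.exists_walk_length_eq_dist a b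
    rw [← hp] at h
    refine wordBall.mono h ?_
    clear h hp
    induction p with
    | nil => simpa using wordBall.one_mem 0
    | cons hadj p ih =>
      rw [SimpleGraph.Walk.length_cons, add_comm]
      exact wordBall.inv_mul_trans ((adj _ _).2 (Or.inr hadj)) ih
  · intro h
    induction n generalizing b with
    | zero =>
      rw [wordBall.zero_eq, Set.mem_singleton_iff, inv_mul_eq_one] at h
      rw [h, SimpleGraph.dist_self]
    | succ n ih =>
      rw [wordBall, pow_succ] at h
      obtain ⟨x, hx, y, hy, hxy⟩ := Set.mem_mul.1 h
      have h1 := ih (b := a * x) (by rwa [inv_mul_cancel_left])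
      have h2 := (adj (a * x) b).1 (by
        rw [mul_inv_rev, mul_assoc, ← hxy, inv_mul_cancel_left, wordBall, pow_one]
        exact hy)
      refine hc.dist_triangle.trans (add_le_add h1 ?_)
      rcases h2 with h2 | h2
      · rw [h2, SimpleGraph.dist_self]; exact Nat.zero_le _
      · exact (SimpleGraph.dist_eq_one_iff_adj.2 h2).le

theorem quotientCayley_dist_le_iff {G : Type*} [Group G] {S : Finset G}
    (hS : Subgroup.closure (S : Set G) = ⊤) {N : Subgroup G} [N.Normal] {a b : G ⧸ N} {n : ℕ} :
    (quotientCayley S N).dist a b ≤ n ↔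
      a⁻¹ * b ∈ wordBall (QuotientGroup.mk' N '' (S : Set G)) n :=
  mulCayley_dist_le_iff (quotientCayley_connected S hS N)

/-! ### Controlled maps and coarse inverses -/

/-- A pointed coarse equivalence between groups with word metrics, with explicit upper control
function `R`, lower control function `r` and density constant `C`. -/
structure IsCoarseApprox {P Q : Type*} [Group P] [Group Q] (S : Set P) (T : Set Q)
    (R r : ℕ → ℕ) (C : ℕ) (f : P → Q) : Prop where
  map_one : f 1 = 1
  upper : ∀ n x y, x⁻¹ * y ∈ wordBall S n → (f x)⁻¹ * f y ∈ wordBall T (R n)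
  lower : ∀ n x y, (f x)⁻¹ * f y ∈ wordBall T n → x⁻¹ * y ∈ wordBall S (r n)
  dense : ∀ q, ∃ x, (f x)⁻¹ * q ∈ wordBall T C

/-- Choosing approximate preimages inverts `f` coarsely; the lower control of `f` becomes the upper
control of the inverse, with an error `C` at each end. -/
theorem IsCoarseApprox.exists_inverse {P Q : Type*} [Group P] [Group Q] {S : Set P} {T : Set Q}
    {R r : ℕ → ℕ} {C : ℕ} {f : P → Q} (hf : IsCoarseApprox S T R r C f) :
    ∃ g : Q → P, g 1 = 1 ∧ (∀ q, (f (g q))⁻¹ * q ∈ wordBall T C) ∧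
      (∀ n x y, x⁻¹ * y ∈ wordBall T n → (g x)⁻¹ * g y ∈ wordBall S (r (C + n + C))) ∧
      ∀ x, (g (f x))⁻¹ * x ∈ wordBall S (r C) := by
  classical
  choose g hg using hf.dense
  -- Resetting the chosen preimage of `1` to `1` keeps the inverse pointed at no cost, since `f 1 =
  -- 1`.
  have key : ∀ q, (f (if q = 1 then 1 else g q))⁻¹ * q ∈ wordBall T C := by
    intro q
    split_ifs with h
    · rw [h, hf.map_one, inv_mul_cancel]
      exact wordBall.one_mem _
    · exact hg q
  refine ⟨fun q => if q = 1 then 1 else g q, by simp, key, fun n x y h => ?_, fun x => ?_⟩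
  · exact hf.lower _ _ _ (wordBall.inv_mul_trans (wordBall.inv_mul_trans (key x) h)
      (wordBall.inv_mul_comm (key y)))
  · exact hf.lower _ _ _ (key (f x))

/-! ### Coarse simple connectedness -/

/-- The map `c` satisfies the cocycle identity on triangles whose edges lie in `E`. -/
def IsCocycleOn {P A : Type*} [Group P] [Group A] (E : Set P) (c : P → P → A) : Prop :=
  ∀ x y z, x⁻¹ * y ∈ E → y⁻¹ * z ∈ E → x⁻¹ * z ∈ E → c x y * c y z = c x z

theorem IsCocycleOn.mono {P A : Type*} [Group P] [Group A] {E E' : Set P} {c : P → P → A}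
    (hc : IsCocycleOn E c) (h : E' ⊆ E) : IsCocycleOn E' c :=
  fun x y z h1 h2 h3 => hc x y z (h h1) (h h2) (h h3)

theorem IsCocycleOn.self {P A : Type*} [Group P] [Group A] {E : Set P} {c : P → P → A}
    (hc : IsCocycleOn E c) (h : 1 ∈ E) (x : P) : c x x = 1 := by
  have := hc x x x (by simpa) (by simpa) (by simpa)
  simpa using this

/-- Coarse simple connectedness with coefficients in the group `A`: every cocycle defined at a
sufficiently large scale is a coboundary. -/
def TrivializesCocycles {P : Type*} [Group P] (S : Set P) (A : Type*) [Group A] : Prop :=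
  ∀ k, ∃ L, ∀ c : P → P → A, IsCocycleOn (wordBall S L) c →
    ∃ u : P → A, ∀ x y, x⁻¹ * y ∈ wordBall S k → c x y = (u x)⁻¹ * u y

/-- Right translation by the inverse of `g` on `P × A`, twisted by `c`. -/
def twistedTranslation {P A : Type*} [Group P] [Group A] (c : P → P → A) (g : P) :
    Equiv.Perm (P × A) where
  toFun p := (p.1 * g⁻¹, p.2 * c p.1 (p.1 * g⁻¹))
  invFun p := (p.1 * g, p.2 * (c (p.1 * g) p.1)⁻¹)
  left_inv p := by simp
  right_inv p := by simp

theorem lift_twistedTranslation_fst {P A ι : Type*} [Group P] [Group A] (φ : FreeGroup ι →* P)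
    (c : P → P → A) (w : FreeGroup ι) (p : P × A) :
    (FreeGroup.lift (fun i => twistedTranslation c (φ (FreeGroup.of i))) w p).1 =
      p.1 * (φ w)⁻¹ := by
  induction w using FreeGroup.induction_on generalizing p with
  | C1 => simp
  | of i => simp [twistedTranslation]
  | inv_of i _ => simp [twistedTranslation, Equiv.Perm.inv_def]
  | mul x y hx hy => simp [hx, hy, mul_assoc]

/-- Think of `P × A` as a covering of `P` with monodromy `c`. Lifting the path spelled by `w` gives
the same result as the single edge joining its endpoints, once the cocycle identity holds at the
scale of `w`. The scale `D` is independent of `c`. -/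
theorem exists_lift_twistedTranslation_eq {P ι : Type*} [Group P] {S : Set P}
    (hS : Subgroup.closure S = ⊤) (φ : FreeGroup ι →* P) (A : Type*) [Group A]
    (w : FreeGroup ι) :
    ∃ D, ∀ c : P → P → A, IsCocycleOn (wordBall S D) c → ∀ x a,
      FreeGroup.lift (fun i => twistedTranslation c (φ (FreeGroup.of i))) w (x, a) =
        (x * (φ w)⁻¹, a * c x (x * (φ w)⁻¹)) := by
  induction w using FreeGroup.induction_on with
  | C1 =>
    refine ⟨0, fun c hc x a => ?_⟩
    simp [hc.self (wordBall.one_mem _)]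
  | of i => exact ⟨0, fun c hc x a => by simp [twistedTranslation]⟩
  | inv_of i _ =>
    obtain ⟨D, hD⟩ := wordBall.exists_mem hS (φ (FreeGroup.of i))
    refine ⟨D, fun c hc x a => ?_⟩
    have h := hc x (x * φ (FreeGroup.of i)) x (by simpa) (by simpa using wordBall.inv_mem hD)
      (by simpa using wordBall.one_mem _)
    rw [hc.self (wordBall.one_mem _)] at h
    simp [twistedTranslation, Equiv.Perm.inv_def, eq_inv_of_mul_eq_one_left h]
  | mul v w hv hw =>
    obtain ⟨D₁, h₁⟩ := hv
    obtain ⟨D₂, h₂⟩ := hw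
    obtain ⟨a₁, e₁⟩ := wordBall.exists_mem hS (φ v)
    obtain ⟨a₂, e₂⟩ := wordBall.exists_mem hS (φ w)
    refine ⟨D₁ + D₂ + (a₁ + a₂), fun c hc x a => ?_⟩
    rw [map_mul, Equiv.Perm.mul_apply, h₂ c (hc.mono (wordBall.mono (by omega))),
      h₁ c (hc.mono (wordBall.mono (by omega))), map_mul, mul_inv_rev, mul_assoc a,
      hc x (x * (φ w)⁻¹), mul_assoc x]
    · rw [inv_mul_cancel_left]
      exact wordBall.mono (by omega) (wordBall.inv_mem e₂)
    · rw [inv_mul_cancel_left]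
      exact wordBall.mono (by omega) (wordBall.inv_mem e₁)
    · rw [mul_assoc, inv_mul_cancel_left, ← mul_inv_rev]
      exact wordBall.mono (by omega) (wordBall.inv_mem (wordBall.mul_mem e₁ e₂))

theorem exists_uniform_bound {α : Type*} {E : Set α} (hE : E.Finite) {p : α → ℕ → Prop}
    (hmono : ∀ a m n, m ≤ n → p a m → p a n) (h : ∀ a ∈ E, ∃ n, p a n) :
    ∃ n, ∀ a ∈ E, p a n := by
  induction E, hE using Set.Finite.induction_on with
  | empty => exact ⟨0, fun a ha => ha.elim⟩
  | @insert a s _ _ ih =>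
    obtain ⟨m, hm⟩ := ih fun b hb => h b (Set.mem_insert_of_mem _ hb)
    obtain ⟨n, hn⟩ := h a (Set.mem_insert _ _)
    refine ⟨m + n, fun b hb => ?_⟩
    rcases hb with rfl | hb
    · exact hmono _ _ _ (by omega) hn
    · exact hmono _ _ _ (by omega) (hm b hb)

/-- At a scale exceeding the finitely many relators, each relator lifts to closed loops in the
covering `G × A`. The action of the free group then descends to `G`, and the orbit of `(1, 1)` is a
global section; its second coordinate is the required `u`. -/
theorem trivializesCocycles_of_isFinitelyPresented {G : Type*} [Group G]
    [Group.IsFinitelyPresented G] {S : Set G} (hfin : S.Finite) (hS : Subgroup.closure S = ⊤)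
    (A : Type*) [Group A] : TrivializesCocycles S A := by
  intro k
  obtain ⟨n, φ, hφ, rels, hrels, hker⟩ := Group.IsFinitelyPresented.out (G := G)
  let s : G → FreeGroup (Fin n) := Function.surjInv hφ
  have hs : ∀ g, φ (s g) = g := Function.surjInv_eq hφ
  -- Besides the relators, the scale must handle the words representing the short elements on which
  -- `c` is to be computed.
  obtain ⟨L, hL⟩ := exists_uniform_bound
    (E := rels ∪ (fun g => s g⁻¹) '' wordBall S k)
    (hrels.union ((wordBall.finite hfin k).image _))
    (p := fun w D => ∀ c : G → G → A, IsCocycleOn (wordBall S D) c → ∀ x a,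
      FreeGroup.lift (fun i => twistedTranslation c (φ (FreeGroup.of i))) w (x, a) =
        (x * (φ w)⁻¹, a * c x (x * (φ w)⁻¹)))
    (fun w m n hmn h c hc => h c (hc.mono (wordBall.mono hmn)))
    (fun w _ => exists_lift_twistedTranslation_eq hS φ A w)
  refine ⟨L, fun c hc => ?_⟩
  set π := FreeGroup.lift (fun i => twistedTranslation c (φ (FreeGroup.of i))) with hπ
  have hle : φ.ker ≤ π.ker := by
    rw [← hker]
    refine Subgroup.normalClosure_le_normal fun w hw => ?_
    have h1 : φ w = 1 := by
      rw [← MonoidHom.mem_ker, ← hker]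
      exact Subgroup.subset_normalClosure hw
    have h2 := hL w (Or.inl hw) c hc
    refine MonoidHom.mem_ker.2 (Equiv.ext fun p => ?_)
    obtain ⟨x, a⟩ := p
    rw [h2, h1, inv_one, mul_one, hc.self (wordBall.one_mem _), mul_one, Equiv.Perm.one_apply]
  have heq : ∀ v w, φ v = φ w → π v = π w := by
    intro v w h
    have : v⁻¹ * w ∈ π.ker := hle (by rw [MonoidHom.mem_ker, map_mul, map_inv, h, inv_mul_cancel])
    rw [MonoidHom.mem_ker, map_mul, map_inv, inv_mul_eq_one] at this
    exact this
  refine ⟨fun x => (π (s x⁻¹) (1, 1)).2, fun x y hxy => ?_⟩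
  have h1 : π (s y⁻¹) = π (s (x⁻¹ * y)⁻¹) * π (s x⁻¹) := by
    rw [← map_mul]
    refine heq _ _ ?_
    rw [map_mul, hs, hs, hs]
    group
  have h2 : π (s x⁻¹) (1, 1) = (x, (π (s x⁻¹) (1, 1)).2) := by
    refine Prod.ext ?_ rfl
    rw [hπ, lift_twistedTranslation_fst, hs, one_mul, inv_inv]
  have h3 := hL (s (x⁻¹ * y)⁻¹) (Or.inr ⟨_, hxy, rfl⟩) c hc x (π (s x⁻¹) (1, 1)).2
  simp only
  rw [h1, Equiv.Perm.mul_apply]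
  nth_rewrite 2 [h2]
  rw [h3, hs]
  simp

/-- Coarse simple connectedness is invariant under coarse equivalence. -/
theorem IsCoarseApprox.trivializesCocycles {P Q A : Type*} [Group P] [Group Q] [Group A]
    {S : Set P} {T : Set Q} {R r : ℕ → ℕ} {C : ℕ} {f : P → Q}
    (hf : IsCoarseApprox S T R r C f) (h : TrivializesCocycles S A) :
    TrivializesCocycles T A := by
  intro k
  obtain ⟨g, -, hg, hgu, -⟩ := hf.exists_inverse
  obtain ⟨L, hL⟩ := h (r (C + k + C))
  refine ⟨R L + (C + k + C), fun c hc => ?_⟩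
  obtain ⟨u, hu⟩ := hL (fun x y => c (f x) (f y)) fun x y z h1 h2 h3 =>
    hc _ _ _ (wordBall.mono (by omega) (hf.upper _ _ _ h1))
      (wordBall.mono (by omega) (hf.upper _ _ _ h2))
      (wordBall.mono (by omega) (hf.upper _ _ _ h3))
  -- Pull `c` back along `f`, trivialize it on `P`, and correct by the short edge from `f (g q)` to
  -- `q`.
  refine ⟨fun q => u (g q) * c (f (g q)) q, fun x y hxy => ?_⟩
  have hx := hg x
  have hy := hg y
  have h1 : c (f (g x)) (f (g y)) * c (f (g y)) y = c (f (g x)) y :=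
    hc _ _ _ (wordBall.mono (by omega)
      (wordBall.inv_mul_trans (wordBall.inv_mul_trans hx hxy) (wordBall.inv_mul_comm hy)))
      (wordBall.mono (by omega) hy) (wordBall.mono (by omega) (wordBall.inv_mul_trans hx hxy))
  have h2 : c (f (g x)) x * c x y = c (f (g x)) y :=
    hc _ _ _ (wordBall.mono (by omega) hx) (wordBall.mono (by omega) hxy)
      (wordBall.mono (by omega) (wordBall.inv_mul_trans hx hxy))
  have h3 := hu (g x) (g y) (hgu _ _ _ hxy)
  simp only at h3 ⊢
  rw [mul_inv_rev, mul_assoc, ← mul_assoc (u (g x))⁻¹, ← h3, h1, ← h2, inv_mul_cancel_left]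

/-! ### Limits of maps between deep quotients -/

/-- Arbitrarily deep finite quotients of `G` and `H` are coarsely equivalent, with uniform control
functions. -/
def HasApproxQuotients {G H : Type*} [Group G] [Group H] (S : Set G) (T : Set H)
    (R r : ℕ → ℕ) (C : ℕ) : Prop :=
  ∀ k, ∃ (N : Subgroup G) (M : Subgroup H) (_ : N.Normal) (_ : M.Normal) (f : G ⧸ N → H ⧸ M),
    N.FiniteIndex ∧ M.FiniteIndex ∧ (∀ g ∈ N, g ∈ wordBall S k → g = 1) ∧
    (∀ g ∈ M, g ∈ wordBall T k → g = 1) ∧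
    IsCoarseApprox (QuotientGroup.mk' N '' S) (QuotientGroup.mk' M '' T) R r C f

/-- An element of `G` whose image in a deep quotient is short is itself short. -/
theorem wordBall.mem_of_mk_mem {G : Type*} [Group G] {S : Set G} {N : Subgroup G} [N.Normal]
    {k m n : ℕ} (hN : ∀ g ∈ N, g ∈ wordBall S k → g = 1) (hk : m + n ≤ k) {g : G}
    (hg : g ∈ wordBall S m)
    (h : (g : G ⧸ N) ∈ wordBall (QuotientGroup.mk' N '' S) n) : g ∈ wordBall S n := by
  obtain ⟨v, hv, hvg⟩ := wordBall.exists_of_mem_image _ h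
  have h1 : g⁻¹ * v ∈ N := QuotientGroup.eq.1 hvg.symm
  have h2 := hN _ h1 (wordBall.mono hk (wordBall.mul_mem (wordBall.inv_mem hg) hv))
  rwa [inv_mul_eq_one.1 h2]

open Filter in
/-- Coarse equivalences between deeper and deeper quotients have a limit, which is a coarse
equivalence between the groups. -/
theorem HasApproxQuotients.exists_isCoarseApprox {G H : Type*} [Group G] [Group H]
    {S : Set G} {T : Set H} (hSf : S.Finite) (hTf : T.Finite) (hS : Subgroup.closure S = ⊤)
    (hT : Subgroup.closure T = ⊤) {R r : ℕ → ℕ} {C : ℕ} (h : HasApproxQuotients S T R r C) :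
    ∃ f : G → H, IsCoarseApprox S T R r C f := by
  choose N M hNn hMn f _ _ hN hM hf using h
  have hlarge : ∀ n, ∀ᶠ k in (hyperfilter ℕ : Filter ℕ), n ≤ k := fun n =>
    Nat.hyperfilter_le_atTop (eventually_ge_atTop n)
  -- Upper control puts the representatives for all `k` in one finite ball, so the ultrafilter
  -- selects a single value.
  have hex : ∀ x : G, ∃ v : H, ∀ᶠ k in (hyperfilter ℕ : Filter ℕ),
      (v : H ⧸ M k) = f k (x : G ⧸ N k) := by
    intro x
    obtain ⟨n, hn⟩ := wordBall.exists_mem hS x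
    have : ∀ k, ∃ v ∈ wordBall T (R n), (v : H ⧸ M k) = f k (x : G ⧸ N k) := by
      intro k
      have h1 := (hf k).upper n 1 (x : G ⧸ N k) (by
        rw [inv_one, one_mul]; exact wordBall.map_mem (QuotientGroup.mk' (N k)) hn)
      rw [(hf k).map_one, inv_one, one_mul] at h1
      exact wordBall.exists_of_mem_image _ h1
    obtain ⟨v, -, hv⟩ := (Ultrafilter.eventually_exists_mem_iff (wordBall.finite hTf _)).1
      (Eventually.of_forall this : ∀ᶠ k in (hyperfilter ℕ : Filter ℕ), _)
    exact ⟨v, hv⟩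
  choose F hF using hex
  have short : ∀ (h : H) (n : ℕ), (∀ᶠ k in (hyperfilter ℕ : Filter ℕ),
      (h : H ⧸ M k) ∈ wordBall (QuotientGroup.mk' (M k) '' T) n) → h ∈ wordBall T n := by
    intro h n hn
    obtain ⟨m, hm⟩ := wordBall.exists_mem hT h
    obtain ⟨k, hk1, hk2⟩ := (hn.and (hlarge (m + n))).exists
    exact wordBall.mem_of_mk_mem (hM k) hk2 hm hk1
  refine ⟨F, ?_, fun n x y hxy => ?_, fun n x y hxy => ?_, fun q => ?_⟩
  · have := short (F 1) 0 ((hF 1).mono fun k hk => by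
      rw [hk]
      have := (hf k).map_one
      rw [← QuotientGroup.mk_one] at this
      rw [this]
      exact wordBall.one_mem _)
    rwa [wordBall.zero_eq, Set.mem_singleton_iff] at this
  · refine short _ _ (((hF x).and (hF y)).mono fun k hk => ?_)
    rw [QuotientGroup.mk_mul, QuotientGroup.mk_inv, hk.1, hk.2]
    refine (hf k).upper _ _ _ ?_
    rw [← QuotientGroup.mk_inv, ← QuotientGroup.mk_mul]
    exact wordBall.map_mem (QuotientGroup.mk' (N k)) hxy
  · obtain ⟨m, hm⟩ := wordBall.exists_mem hS (x⁻¹ * y)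
    obtain ⟨k, ⟨hkx, hky⟩, hk⟩ := (((hF x).and (hF y)).and (hlarge (m + r n))).exists
    refine wordBall.mem_of_mk_mem (hN k) hk hm ?_
    rw [QuotientGroup.mk_mul, QuotientGroup.mk_inv]
    refine (hf k).lower _ _ _ ?_
    rw [← hkx, ← hky, ← QuotientGroup.mk_inv, ← QuotientGroup.mk_mul]
    exact wordBall.map_mem (QuotientGroup.mk' (M k)) hxy
  · obtain ⟨m, hm⟩ := wordBall.exists_mem hT q
    -- An approximate preimage of `q` has image within `m + C` of `f k 1 = 1`; lower control bounds
    -- its length independently of `k`.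
    have : ∀ k, ∃ x ∈ wordBall S (r (m + C)), (f k (x : G ⧸ N k))⁻¹ * (q : H ⧸ M k) ∈
        wordBall (QuotientGroup.mk' (M k) '' T) C := by
      intro k
      obtain ⟨p, hp⟩ := (hf k).dense (q : H ⧸ M k)
      have h1 : (f k 1)⁻¹ * (q : H ⧸ M k) ∈ wordBall (QuotientGroup.mk' (M k) '' T) m := by
        rw [(hf k).map_one, inv_one, one_mul]
        exact wordBall.map_mem (QuotientGroup.mk' (M k)) hm
      have h2 := (hf k).lower _ _ _ (wordBall.inv_mul_trans h1 (wordBall.inv_mul_comm hp))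
      rw [inv_one, one_mul] at h2
      obtain ⟨x, hx, rfl⟩ := wordBall.exists_of_mem_image _ h2
      exact ⟨x, hx, hp⟩
    obtain ⟨x, -, hx⟩ := (Ultrafilter.eventually_exists_mem_iff (wordBall.finite hSf _)).1
      (Eventually.of_forall this : ∀ᶠ k in (hyperfilter ℕ : Filter ℕ), _)
    refine ⟨x, short _ _ ((hx.and (hF x)).mono fun k hk => ?_)⟩
    rw [QuotientGroup.mk_mul, QuotientGroup.mk_inv, hk.2]
    exact hk.1

/-! ### Lifting to the groups and isomorphism of the kernels -/

/-- A controlled map between deep quotients lifts to a map between the groups, which restricts to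
a homomorphism on the kernel. -/
theorem exists_equivariant_lift {P Q : Type*} [Group P] [Group Q] {S : Set P} {T : Set Q}
    (hS : Subgroup.closure S = ⊤) (hA : TrivializesCocycles S Q) (R : ℕ → ℕ) :
    ∃ K, ∀ (N : Subgroup P) (M : Subgroup Q) [N.Normal] [M.Normal]
      (_ : ∀ g ∈ M, g ∈ wordBall T K → g = 1) (f : P ⧸ N → Q ⧸ M) (_ : f 1 = 1)
      (_ : ∀ n x y, x⁻¹ * y ∈ wordBall (QuotientGroup.mk' N '' S) n →
        (f x)⁻¹ * f y ∈ wordBall (QuotientGroup.mk' M '' T) (R n)),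
      ∃ F : P → Q, (∀ x, (F x : Q ⧸ M) = f x) ∧
        (∀ x y, x⁻¹ * y ∈ wordBall S 1 → (F x)⁻¹ * F y ∈ wordBall T K) ∧
        ∀ n ∈ N, ∀ x, F (n * x) = F n * F x := by
  classical
  obtain ⟨L₀, hL₀⟩ := hA 1
  -- The scale must be at least `1` so that increments along generators are lifted correctly.
  let L := max L₀ 1
  let K := R L
  -- The failure of the cocycle identity is an element of `M` and a product of three elements of the
  -- ball of radius `R L`.
  refine ⟨K + K + K, fun N M _ _ hM f hf1 hf => ?_⟩
  let σ : Q ⧸ M → Q := fun q =>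
    if h : ∃ w ∈ wordBall T K, (w : Q ⧸ M) = q then h.choose else 1
  have hσK : ∀ q, σ q ∈ wordBall T K := by
    intro q
    by_cases h : ∃ w ∈ wordBall T K, (w : Q ⧸ M) = q
    · simp only [σ, dif_pos h]
      exact h.choose_spec.1
    · simp only [σ, dif_neg h]
      exact wordBall.one_mem _
  have hσ : ∀ q ∈ wordBall (QuotientGroup.mk' M '' T) K, (σ q : Q ⧸ M) = q := by
    intro q hq
    have h : ∃ w ∈ wordBall T K, (w : Q ⧸ M) = q := wordBall.exists_of_mem_image _ hq
    simp only [σ, dif_pos h]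
    exact h.choose_spec.2
  -- Since `c` depends only on classes modulo `N`, it is invariant under left translation by `N`;
  -- this yields `F (n * x) = F n * F x`.
  let c : P → P → Q := fun x y => σ ((f x)⁻¹ * f y)
  have hcf : ∀ x y : P, x⁻¹ * y ∈ wordBall S L → (c x y : Q ⧸ M) = (f x)⁻¹ * f y := by
    intro x y hxy
    refine hσ _ (hf L _ _ ?_)
    rw [← QuotientGroup.mk_inv, ← QuotientGroup.mk_mul]
    exact wordBall.map_mem (QuotientGroup.mk' N) hxy
  have hc : IsCocycleOn (wordBall S L) c := by
    intro x y z h1 h2 h3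
    have hmem : (c x y * c y z)⁻¹ * c x z ∈ M := by
      rw [← QuotientGroup.eq, QuotientGroup.mk_mul, hcf _ _ h1, hcf _ _ h2, hcf _ _ h3]
      group
    exact inv_mul_eq_one.1 (hM _ hmem (wordBall.mul_mem
      (wordBall.inv_mem (wordBall.mul_mem (hσK _) (hσK _))) (hσK _)))
  obtain ⟨u, hu⟩ := hL₀ c (hc.mono (wordBall.mono (le_max_left _ _)))
  have hFc : ∀ x y, x⁻¹ * y ∈ wordBall S 1 → ((u 1)⁻¹ * u x)⁻¹ * ((u 1)⁻¹ * u y) = c x y := by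
    intro x y hxy
    rw [hu x y hxy]
    group
  have hstep : ∀ x, ∀ s ∈ S, x⁻¹ * (x * s) ∈ wordBall S 1 := by
    intro x s hs
    rw [inv_mul_cancel_left]
    exact wordBall.subset_one hs
  refine ⟨fun x => (u 1)⁻¹ * u x, fun x => ?_, fun x y hxy => ?_, fun n hn x => ?_⟩
  · have := eq_of_increments_eq hS (u := fun x : P => (((u 1)⁻¹ * u x : Q) : Q ⧸ M))
      (v := fun x : P => f x) (by
        rw [inv_mul_cancel, QuotientGroup.mk_one, QuotientGroup.mk_one, hf1]) (by
        intro x s hs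
        rw [← QuotientGroup.mk_inv, ← QuotientGroup.mk_mul, hFc _ _ (hstep x s hs),
          hcf _ _ (wordBall.mono (le_max_right _ _) (hstep x s hs))])
    exact congrFun this x
  · simp only
    rw [hFc x y hxy]
    exact wordBall.mono (by omega) (hσK _)
  · have hn1 : ∀ x : P, ((n * x : P) : P ⧸ N) = x := by
      intro x
      rw [QuotientGroup.mk_mul, (QuotientGroup.eq_one_iff n).2 hn, one_mul]
    have := eq_of_increments_eq hS (u := fun x : P => (u 1)⁻¹ * u (n * x))
      (v := fun x : P => (u 1)⁻¹ * u n * ((u 1)⁻¹ * u x)) (by simp) (by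
        intro x s hs
        have h1 := hFc (n * x) (n * (x * s)) (by
          rw [mul_inv_rev, mul_assoc, inv_mul_cancel_left]
          exact hstep x s hs)
        have h2 := hFc x (x * s) (hstep x s hs)
        have h3 : c (n * x) (n * (x * s)) = c x (x * s) := by
          simp only [c, hn1]
        rw [h1, h3, ← h2]
        group)
    exact congrFun this x

/-- If the map covered by `E` is close to the identity, then `E` is the identity on the kernel. -/
theorem eq_self_of_covers_close_to_id {P : Type*} [Group P] {S : Set P}
    (hS : Subgroup.closure S = ⊤) {N : Subgroup P} [N.Normal] {k D K : ℕ}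
    (hN : ∀ g ∈ N, g ∈ wordBall S k → g = 1) (hk : D + K + D + 1 ≤ k) {E : P → P}
    {e : P ⧸ N → P ⧸ N} (he1 : e 1 = 1)
    (he : ∀ x, (e x)⁻¹ * x ∈ wordBall (QuotientGroup.mk' N '' S) D)
    (hE1 : E 1 = 1) (hE : ∀ x, (E x : P ⧸ N) = e x)
    (hEK : ∀ x y, x⁻¹ * y ∈ wordBall S 1 → (E x)⁻¹ * E y ∈ wordBall S K) :
    ∀ n ∈ N, E n = n := by
  classical
  -- The correction `t` makes `E x * t x` congruent to `x` modulo `N`. Its increments then differ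
  -- from the generators by elements of `N` of length at most `D + K + D + 1`, hence trivial.
  -- Requiring `t = 1` at the trivial class removes the correction on `N`.
  have hex : ∀ q : P ⧸ N, ∃ t : P, t ∈ wordBall S D ∧ (t : P ⧸ N) = (e q)⁻¹ * q ∧
      (q = 1 → t = 1) := by
    intro q
    by_cases hq : q = 1
    · refine ⟨1, wordBall.one_mem _, ?_, fun _ => rfl⟩
      rw [hq, he1, inv_one, one_mul, QuotientGroup.mk_one]
    · obtain ⟨t, ht, h⟩ := wordBall.exists_of_mem_image _ (he q)
      exact ⟨t, ht, h, fun h => (hq h).elim⟩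
  choose t htD ht ht1 using hex
  have key := eq_of_increments_eq hS (u := fun x : P => E x * t x) (v := fun x => x)
    (by rw [hE1, ht1 _ (QuotientGroup.mk_one N), one_mul]) (by
      intro x s hs
      have hmk : ∀ x : P, ((E x * t x : P) : P ⧸ N) = x := by
        intro x
        rw [QuotientGroup.mk_mul, hE, ht, mul_inv_cancel_left]
      have h1 : ((E x * t x)⁻¹ * (E (x * s) * t (x * s : P))) * s⁻¹ ∈ N := by
        rw [← QuotientGroup.eq_one_iff, QuotientGroup.mk_mul, QuotientGroup.mk_mul,
          QuotientGroup.mk_inv, hmk, hmk, QuotientGroup.mk_mul, QuotientGroup.mk_inv]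
        group
      have h2 : ((E x * t x)⁻¹ * (E (x * s) * t (x * s : P))) * s⁻¹ ∈
          wordBall S (D + K + D + 1) := by
        have h3 := hEK x (x * s) (by
          rw [inv_mul_cancel_left]; exact wordBall.subset_one hs)
        have h4 := wordBall.mul_mem (wordBall.mul_mem (wordBall.mul_mem
          (wordBall.inv_mem (htD x)) h3) (htD (x * s : P)))
          (wordBall.inv_mem (wordBall.subset_one hs))
        convert h4 using 1
        group
      have h5 := hN _ h1 (wordBall.mono hk h2)
      rw [inv_mul_cancel_left]
      exact mul_inv_eq_one.1 h5)
  intro n hn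
  have h1 := congrFun key n
  rwa [ht1 _ ((QuotientGroup.eq_one_iff n).2 hn), mul_one] at h1

/-- If deep quotients of a finitely presented group and another group are uniformly coarsely
equivalent, then the corresponding kernels are eventually isomorphic. -/
theorem HasApproxQuotients.commensurableViaNormal {G H : Type*} [Group G] [Group H]
    [Group.IsFinitelyPresented G] {S : Set G} {T : Set H} (hSf : S.Finite) (hTf : T.Finite)
    (hS : Subgroup.closure S = ⊤) (hT : Subgroup.closure T = ⊤) {R r : ℕ → ℕ} {C : ℕ}
    (h : HasApproxQuotients S T R r C) : CommensurableViaNormal G H := by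
  obtain ⟨f₀, hf₀⟩ := h.exists_isCoarseApprox hSf hTf hS hT
  obtain ⟨K₁, hK₁⟩ := exists_equivariant_lift (T := T) hS
    (trivializesCocycles_of_isFinitelyPresented hSf hS H) R
  -- Coarse invariance supplies for `H` what finite presentation supplies for `G`.
  obtain ⟨K₂, hK₂⟩ := exists_equivariant_lift (T := S) hT
    (hf₀.trivializesCocycles (trivializesCocycles_of_isFinitelyPresented hSf hS G))
    (fun n => r (C + n + C))
  obtain ⟨N, M, _, _, f, hNf, hMf, hN, hM, hf⟩ := h
    -- Deep enough for both lifts and for both comparisons of a composite with the identity.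
    (K₁ + K₂ + (r C + K₂ * K₁ + r C + 1) + (C + K₁ * K₂ + C + 1))
  obtain ⟨g, hg1, hfg, hg, hgf⟩ := hf.exists_inverse
  obtain ⟨F, hF, hFK, hFN⟩ := hK₁ N M
    (fun x hx hx' => hM x hx (wordBall.mono (by omega) hx')) f hf.map_one hf.upper
  obtain ⟨E, hE, hEK, hEM⟩ := hK₂ M N
    (fun x hx hx' => hN x hx (wordBall.mono (by omega) hx')) g hg1 hg
  have hF1 : F 1 = 1 := by simpa using hFN 1 (one_mem _) 1
  have hE1 : E 1 = 1 := by simpa using hEM 1 (one_mem _) 1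
  have hEF := eq_self_of_covers_close_to_id hS hN (D := r C) (K := K₂ * K₁) (by omega)
    (E := fun x => E (F x)) (e := fun x => g (f x)) (by simp only [hf.map_one, hg1]) hgf
    (by simp only [hF1, hE1]) (fun x => by simp only [hE, hF])
    (fun x y hxy => wordBall.lipschitz hEK K₁ (hFK x y hxy))
  have hFE := eq_self_of_covers_close_to_id hT hM (D := C) (K := K₁ * K₂) (by omega)
    (E := fun x => F (E x)) (e := fun x => f (g x)) (by simp only [hf.map_one, hg1]) hfg
    (by simp only [hF1, hE1]) (fun x => by simp only [hE, hF])
    (fun x y hxy => wordBall.lipschitz hFK K₂ (hEK x y hxy))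
  refine ⟨N, M, ‹_›, hNf, ‹_›, hMf, ⟨⟨⟨fun n => ⟨F n, ?_⟩, fun m => ⟨E m, ?_⟩, ?_, ?_⟩, ?_⟩⟩⟩
  · rw [← QuotientGroup.eq_one_iff, hF, (QuotientGroup.eq_one_iff _).2 n.2, hf.map_one]
  · rw [← QuotientGroup.eq_one_iff, hE, (QuotientGroup.eq_one_iff _).2 m.2, hg1]
  · exact fun n => Subtype.ext (hEF n n.2)
  · exact fun m => Subtype.ext (hFE m m.2)
  · exact fun n n' => Subtype.ext (hFN n n.2 n')

/-! ### From box spaces to deep quotients -/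

/-- Connectedness of the Cayley graph, as an induction principle along edges. -/
theorem forall_of_wordBall_one {P : Type*} [Group P] {S : Set P} (hS : Subgroup.closure S = ⊤)
    {p : P → Prop} (h1 : p 1) (h : ∀ a b, a⁻¹ * b ∈ wordBall S 1 → p a → p b) (g : P) : p g := by
  have hg : g ∈ Subgroup.closure S := hS ▸ Subgroup.mem_top g
  have key : ∀ a, p a ↔ p (a * g) := by
    induction hg using Subgroup.closure_induction with
    | mem s hs =>
      intro a
      have hs' : a⁻¹ * (a * s) ∈ wordBall S 1 := by
        rw [inv_mul_cancel_left]; exact wordBall.subset_one hs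
      exact ⟨h _ _ hs', h _ _ (wordBall.inv_mul_comm hs')⟩
    | one => simp
    | mul x y _ _ hx hy => exact fun a => (hx a).trans (by rw [← mul_assoc]; exact hy _)
    | inv x _ hx => exact fun a => by simpa using (hx (a * x⁻¹)).symm
  simpa using (key 1).1 h1

theorem GroupFiltration.exists_forall_eq_one {G : Type*} [Group G] (N : GroupFiltration G)
    {E : Set G} (hE : E.Finite) : ∃ i₀, ∀ i ≥ i₀, ∀ g ∈ N.subgroup i, g ∈ E → g = 1 := by
  obtain ⟨n, hn⟩ := exists_uniform_bound hE
    (p := fun g m => ∀ i ≥ m, g ∈ N.subgroup i → g = 1)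
    (fun g m n hmn h i hi => h i (hmn.trans hi)) (fun g _ => by
      by_contra! hcon
      obtain ⟨_, _, _, hg⟩ := hcon 0
      refine hg ?_
      rw [← Subgroup.mem_bot, ← N.iInf_eq_bot, Subgroup.mem_iInf]
      intro i
      obtain ⟨j, hj, hgj, -⟩ := hcon i
      exact N.antitone hj hgj)
  exact ⟨n, fun i hi g hg hgE => hn g hgE i hi hg⟩

namespace BoxSpace

variable {G : Type*} [Group G] {S : Finset G} {hS : Subgroup.closure (S : Set G) = ⊤}
  {N : GroupFiltration G}

theorem natDist_of_index_ne {x y : BoxSpace S hS N} (h : x.index ≠ y.index) :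
    natDist x y = (quotientCayley S (N.subgroup x.index)).diam +
      (quotientCayley S (N.subgroup y.index)).diam :=
  natDist_of_ne h _ _

theorem natDist_le_diam_add_diam (x y : BoxSpace S hS N) :
    natDist x y ≤ (quotientCayley S (N.subgroup x.index)).diam +
      (quotientCayley S (N.subgroup y.index)).diam := by
  obtain ⟨i, a⟩ := x
  obtain ⟨j, b⟩ := y
  by_cases h : i = j
  · subst h
    rw [natDist_same]
    exact (quotientCayley_dist_le_diam S hS _ a b).trans (Nat.le_add_right _ _)
  · rw [natDist_of_ne h]

theorem nndist_eq (x y : BoxSpace S hS N) : nndist x y = (natDist x y : ℝ≥0) := by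
  ext
  rw [coe_nndist]
  rfl

theorem diam_le_of_forall_dist_le {i n : ℕ}
    (h : ∀ a b, (quotientCayley S (N.subgroup i)).dist a b ≤ n) :
    (quotientCayley S (N.subgroup i)).diam ≤ n := by
  obtain ⟨a, b, hab⟩ := (quotientCayley S (N.subgroup i)).exists_dist_eq_diam
  rw [← hab]
  exact h a b

/-- The components of the box space of an infinite group have diameters tending to infinity. -/
theorem exists_forall_lt_diam {G : Type*} [Group G] [Infinite G] {S : Finset G}
    (hS : Subgroup.closure (S : Set G) = ⊤) (N : GroupFiltration G) (d : ℕ) :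
    ∃ i₀, ∀ i ≥ i₀, d < (quotientCayley S (N.subgroup i)).diam := by
  have hfin := wordBall.finite S.finite_toSet d
  -- If `g` became short in a quotient, `g⁻¹ * w` would lie in the kernel for some `w` in the ball;
  -- deep kernels exclude this finite set.
  obtain ⟨g, hg⟩ := hfin.exists_notMem
  obtain ⟨i₀, hi₀⟩ := N.exists_forall_eq_one (hfin.image (fun w => g⁻¹ * w))
  refine ⟨i₀, fun i hi => ?_⟩
  by_contra! hcon
  have h1 := (quotientCayley_dist_le_iff hS).1
    ((quotientCayley_dist_le_diam S hS (N.subgroup i) 1 g).trans hcon)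
  rw [inv_one, one_mul] at h1
  obtain ⟨w, hw, hwg⟩ := wordBall.exists_of_mem_image _ h1
  have h2 := hi₀ i hi (g⁻¹ * w) (QuotientGroup.eq.1 hwg.symm) ⟨w, hw, rfl⟩
  rw [inv_mul_eq_one] at h2
  exact hg (h2 ▸ hw)

theorem finite_iff_exists_natDist_le :
    Finite G ↔ ∃ b, ∀ x y : BoxSpace S hS N, natDist x y ≤ b := by
  constructor
  · intro _
    obtain ⟨n, hn⟩ := wordBall.exists_subset hS (Set.finite_univ (α := G))
    have hd : ∀ i, (quotientCayley S (N.subgroup i)).diam ≤ n := by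
      refine fun i => diam_le_of_forall_dist_le fun a b => ?_
      obtain ⟨g, hg⟩ := QuotientGroup.mk'_surjective (N.subgroup i) (a⁻¹ * b)
      rw [quotientCayley_dist_le_iff hS, ← hg]
      exact wordBall.map_mem _ (hn (Set.mem_univ g))
    exact ⟨n + n, fun x y => (natDist_le_diam_add_diam x y).trans (add_le_add (hd _) (hd _))⟩
  · rintro ⟨b, hb⟩
    by_contra hcon
    rw [not_finite_iff_infinite] at hcon
    obtain ⟨i, hi⟩ := exists_forall_lt_diam hS N b
    obtain ⟨u, v, huv⟩ := (quotientCayley S (N.subgroup i)).exists_dist_eq_diam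
    have h1 := hb ⟨i, u⟩ ⟨i, v⟩
    rw [natDist_same, huv] at h1
    exact absurd h1 (not_le.2 (hi i le_rfl))

end BoxSpace

section Controls

variable {G H : Type*} [Group G] [Group H] {S : Finset G}
  {hS : Subgroup.closure (S : Set G) = ⊤} {T : Finset H}
  {hT : Subgroup.closure (T : Set H) = ⊤} {N : GroupFiltration G} {M : GroupFiltration H}

open BoxSpace

/-- Integral control functions for a coarse equivalence of box spaces. -/
structure BoxSpace.IsControlled (φ : BoxSpace S hS N → BoxSpace T hT M) (R r : ℕ → ℕ) (C : ℕ) :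
    Prop where
  upper : ∀ n x y, natDist x y ≤ n → natDist (φ x) (φ y) ≤ R n
  lower : ∀ n x y, natDist (φ x) (φ y) ≤ n → natDist x y ≤ r n
  dense : ∀ y, ∃ x, natDist (φ x) y ≤ C

/-- Continuity bounds `ρ₂` on `[0, n]`, and properness makes the preimage of `[0, n]` under `ρ₁`
bounded. -/
theorem IsCoarseEquivalence.exists_isControlled {φ : BoxSpace S hS N → BoxSpace T hT M}
    (h : IsCoarseEquivalence φ) : ∃ R r C, BoxSpace.IsControlled φ R r C := by
  obtain ⟨⟨ρ₁, ρ₂, h₁, h₂, hρ⟩, C, -, hC⟩ := h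
  have hR : ∀ n : ℕ, ∃ R : ℕ, ∀ x y, natDist x y ≤ n → natDist (φ x) (φ y) ≤ R := by
    intro n
    obtain ⟨B, hB⟩ := ((isCompact_Icc (a := (0 : ℝ≥0)) (b := n)).image h₂.continuous).bddAbove
    obtain ⟨R, hR⟩ := exists_nat_ge B
    refine ⟨R, fun x y hxy => ?_⟩
    have h3 := (hρ x y).2.trans ((hB (Set.mem_image_of_mem ρ₂
      (Set.mem_Icc.2 ⟨zero_le, by rw [nndist_eq]; exact_mod_cast hxy⟩))).trans hR)
    rw [nndist_eq] at h3
    exact_mod_cast h3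
  have hr : ∀ n : ℕ, ∃ r : ℕ, ∀ x y, natDist (φ x) (φ y) ≤ n → natDist x y ≤ r := by
    intro n
    obtain ⟨B, hB⟩ := (h₁.isCompact_preimage
      (isCompact_Icc (a := (0 : ℝ≥0)) (b := n))).bddAbove
    obtain ⟨r, hr⟩ := exists_nat_ge B
    refine ⟨r, fun x y hxy => ?_⟩
    have h3 : nndist x y ≤ r := (hB (show ρ₁ (nndist x y) ∈ Set.Icc 0 (n : ℝ≥0) from
      ⟨zero_le, (hρ x y).1.trans (by rw [nndist_eq]; exact_mod_cast hxy)⟩)).trans hr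
    rw [nndist_eq] at h3
    exact_mod_cast h3
  choose R hR using hR
  choose r hr using hr
  obtain ⟨C', hC'⟩ := exists_nat_ge C
  refine ⟨R, r, C', hR, hr, fun y => ?_⟩
  obtain ⟨x, hx⟩ := hC y
  refine ⟨x, ?_⟩
  have h3 : ((natDist (φ x) y : ℕ) : ℝ) ≤ (C' : ℝ) := hx.trans hC'
  exact_mod_cast h3

variable {φ : BoxSpace S hS N → BoxSpace T hT M} {R r : ℕ → ℕ} {C : ℕ}

theorem BoxSpace.IsControlled.finite_iff (h : BoxSpace.IsControlled φ R r C) :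
    Finite G ↔ Finite H := by
  rw [finite_iff_exists_natDist_le (hS := hS) (N := N),
    finite_iff_exists_natDist_le (hS := hT) (N := M)]
  constructor
  · rintro ⟨b, hb⟩
    refine ⟨C + R b + C, fun y y' => ?_⟩
    obtain ⟨x, hx⟩ := h.dense y
    obtain ⟨x', hx'⟩ := h.dense y'
    have h1 := h.upper _ _ _ (hb x x')
    have h2 := natDist_triangle y (φ x) y'
    have h3 := natDist_triangle (φ x) (φ x') y'
    rw [natDist_comm y (φ x)] at h2
    omega
  · rintro ⟨b, hb⟩
    exact ⟨r b, fun x y => h.lower _ _ _ (hb _ _)⟩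

/-- Deep components are mapped to deep components. -/
theorem BoxSpace.IsControlled.exists_forall_le_index [Infinite G]
    (h : BoxSpace.IsControlled φ R r C) (j₀ : ℕ) :
    ∃ i₀, ∀ x, i₀ ≤ x.index → j₀ ≤ (φ x).index := by
  by_cases hex : ∃ x₀, (φ x₀).index < j₀
  · obtain ⟨x₀, hx₀⟩ := hex
    -- Points with images in the finitely many shallow components lie within `r (b + b)` of `x₀`,
    -- which is impossible from a different component of larger diameter.
    let b := ∑ j ∈ Finset.range j₀, (quotientCayley T (M.subgroup j)).diam
    have hb : ∀ j < j₀, (quotientCayley T (M.subgroup j)).diam ≤ b := fun j hj =>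
      Finset.single_le_sum (f := fun j => (quotientCayley T (M.subgroup j)).diam)
        (fun _ _ => Nat.zero_le _) (Finset.mem_range.2 hj)
    obtain ⟨i₁, hi₁⟩ := exists_forall_lt_diam hS N (r (b + b))
    refine ⟨max i₁ (x₀.index + 1), fun x hx => ?_⟩
    by_contra! hcon
    have h1 := h.lower (b + b) x x₀
      ((natDist_le_diam_add_diam _ _).trans (add_le_add (hb _ hcon) (hb _ hx₀)))
    rw [natDist_of_index_ne (by omega)] at h1
    have h2 := hi₁ x.index (by omega)
    omega
  · exact ⟨0, fun x _ => by push Not at hex; exact hex x⟩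

/-- Adjacent points cannot land in different components when one of these is deep, so `φ` maps a
deep component into one component. A left translation then makes the map pointed. -/
theorem BoxSpace.IsControlled.hasApproxQuotients [Infinite G] [Infinite H]
    (h : BoxSpace.IsControlled φ R r C) :
    HasApproxQuotients (S : Set G) (T : Set H) R r C := by
  intro k
  obtain ⟨i₁, hi₁⟩ := N.exists_forall_eq_one (wordBall.finite S.finite_toSet k)
  obtain ⟨j₁, hj₁⟩ := M.exists_forall_eq_one (wordBall.finite T.finite_toSet k)
  obtain ⟨j₂, hj₂⟩ := exists_forall_lt_diam hT M (R 1 + C)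
  obtain ⟨i₂, hi₂⟩ := h.exists_forall_le_index (max j₁ j₂)
  obtain ⟨i₃, hi₃⟩ := exists_forall_lt_diam hS N (r (C + 1 + C))
  let i := max i₁ (max i₂ i₃)
  have hindex : ∀ a, max j₁ j₂ ≤ (φ ⟨i, a⟩).index := fun a => hi₂ _ (by simp only; omega)
  let j := (φ ⟨i, 1⟩).index
  have hj : max j₁ j₂ ≤ j := hindex 1
  have hconst : ∀ a, (φ ⟨i, a⟩).index = j := by
    refine forall_of_wordBall_one
      (wordBall.closure_image hS (QuotientGroup.mk'_surjective (N.subgroup i))) rfl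
      fun a b hab ha => ?_
    have h1 := h.upper 1 ⟨i, a⟩ ⟨i, b⟩ (by
      rw [natDist_same]; exact (quotientCayley_dist_le_iff hS).2 hab)
    by_contra hne
    rw [natDist_of_index_ne (by rw [ha]; exact Ne.symm hne), ha] at h1
    have := hj₂ j (by omega)
    omega
  have hex : ∀ a, ∃ q : H ⧸ M.subgroup j, φ ⟨i, a⟩ = ⟨j, q⟩ := by
    intro a
    have h1 := hconst a
    generalize φ ⟨i, a⟩ = y at h1
    obtain ⟨j', q⟩ := y
    simp only at h1
    subst h1
    exact ⟨q, rfl⟩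
  choose f hf using hex
  -- Walk through the target component. If a neighbour were approximated only from another source
  -- component, that point would be within `r (C + 1 + C)` of component `i`, contradicting the size
  -- of its diameter.
  have hdense : ∀ q : H ⧸ M.subgroup j, ∃ a, natDist (φ ⟨i, a⟩) ⟨j, q⟩ ≤ C := by
    intro q
    have h0 := forall_of_wordBall_one
      (wordBall.closure_image hT (QuotientGroup.mk'_surjective (M.subgroup j)))
      (p := fun q => ∃ a, natDist (φ ⟨i, a⟩) ⟨j, f 1 * q⟩ ≤ C)
      ⟨1, by rw [hf, mul_one, natDist_self]; exact Nat.zero_le _⟩ (by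
        rintro q q' hq ⟨a, ha⟩
        obtain ⟨x, hx⟩ := h.dense ⟨j, f 1 * q'⟩
        by_cases hxi : x.index = i
        · obtain ⟨i', a'⟩ := x
          simp only at hxi
          subst hxi
          exact ⟨a', hx⟩
        · have h1 : natDist (⟨j, f 1 * q⟩ : BoxSpace T hT M) ⟨j, f 1 * q'⟩ ≤ 1 := by
            rw [natDist_same, quotientCayley_dist_le_iff hT]
            simpa [mul_assoc] using hq
          have h2 := natDist_triangle (φ ⟨i, a⟩) ⟨j, f 1 * q'⟩ (φ x)
          have h3 := natDist_triangle (φ ⟨i, a⟩) ⟨j, f 1 * q⟩ ⟨j, f 1 * q'⟩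
          rw [natDist_comm ⟨j, f 1 * q'⟩ (φ x)] at h2
          have h4 := h.lower (C + 1 + C) ⟨i, a⟩ x (by omega)
          rw [natDist_of_index_ne (Ne.symm hxi)] at h4
          have h5 := hi₃ i (by omega)
          simp only at h4
          omega) ((f 1)⁻¹ * q)
    simpa using h0
  refine ⟨N.subgroup i, M.subgroup j, inferInstance, inferInstance, fun a => (f 1)⁻¹ * f a,
    inferInstance, inferInstance, hi₁ i (by omega), hj₁ j (by omega), ?_⟩
  have hinv : ∀ a b, ((f 1)⁻¹ * f a)⁻¹ * ((f 1)⁻¹ * f b) = (f a)⁻¹ * f b := by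
    intro a b
    group
  refine ⟨inv_mul_cancel _, fun n a b hab => ?_, fun n a b hab => ?_, fun q => ?_⟩
  · rw [← quotientCayley_dist_le_iff hS, ← natDist_same (hS := hS)] at hab
    have h1 := h.upper n _ _ hab
    rwa [hf, hf, natDist_same, quotientCayley_dist_le_iff hT, ← hinv] at h1
  · rw [hinv, ← quotientCayley_dist_le_iff hT, ← natDist_same (hS := hT), ← hf, ← hf] at hab
    have h1 := h.lower n _ _ hab
    rwa [natDist_same, quotientCayley_dist_le_iff hS] at h1
  · obtain ⟨a, ha⟩ := hdense (f 1 * q)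
    refine ⟨a, ?_⟩
    rw [hf, natDist_same, quotientCayley_dist_le_iff hT] at ha
    convert ha using 1
    group

end Controls

theorem commensurableViaNormal_of_finite (G H : Type*) [Group G] [Group H] [Finite G] [Finite H] :
    CommensurableViaNormal G H :=
  ⟨⊥, ⊥, inferInstance, inferInstance, inferInstance, inferInstance,
    ⟨(MulEquiv.ofUnique : (⊥ : Subgroup G) ≃* (⊥ : Subgroup H))⟩⟩

theorem CoarselyEquivalent.commensurableViaNormal {G H : Type*} [Group G] [Group H]
    [Group.IsFinitelyPresented G] {S : Finset G} {hS : Subgroup.closure (S : Set G) = ⊤}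
    {T : Finset H} {hT : Subgroup.closure (T : Set H) = ⊤} {N : GroupFiltration G}
    {M : GroupFiltration H} (h : CoarselyEquivalent (BoxSpace S hS N) (BoxSpace T hT M)) :
    CommensurableViaNormal G H := by
  obtain ⟨φ, hφ⟩ := h
  obtain ⟨R, r, C, hC⟩ := hφ.exists_isControlled
  -- Diameters stay bounded for finite groups, so that case is settled separately by the trivial
  -- subgroups.
  rcases finite_or_infinite G with hG | hG
  · have := hC.finite_iff.1 hG
    exact commensurableViaNormal_of_finite G H
  · have : Infinite H := by
      rw [← not_finite_iff_infinite, ← hC.finite_iff, not_finite_iff_infinite]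
      exact hG
    exact hC.hasApproxQuotients.commensurableViaNormal S.finite_toSet T.finite_toSet hS hT

/-! ### Intrinsic filtrations -/

/-- The intersection of the kernels of all homomorphisms to symmetric groups of degree less
than `n`. -/
def permCore (K : Type*) [Group K] (n : ℕ) : Subgroup K :=
  ⨅ p : Σ m : Fin n, K →* Equiv.Perm (Fin m), p.2.ker

namespace permCore

variable {K L : Type*} [Group K] [Group L]

theorem mem_iff {n : ℕ} {x : K} :
    x ∈ permCore K n ↔ ∀ m < n, ∀ f : K →* Equiv.Perm (Fin m), f x = 1 := by
  simp only [permCore, Subgroup.mem_iInf, MonoidHom.mem_ker]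
  exact ⟨fun h m hm f => h ⟨⟨m, hm⟩, f⟩, fun h p => h p.1 p.1.2 p.2⟩

theorem antitone : Antitone (permCore K) := fun _ _ hmn _ hx =>
  mem_iff.2 fun m hm f => mem_iff.1 hx m (hm.trans_le hmn) f

/-- Precomposition with an isomorphism permutes the defining homomorphisms. This gives
characteristicity and lets `e : K ≃* L` match the two filtrations. -/
theorem map_mem (e : K ≃* L) {n : ℕ} {x : K} (hx : x ∈ permCore K n) : e x ∈ permCore L n :=
  mem_iff.2 fun m hm f => mem_iff.1 hx m hm (f.comp e.toMonoidHom)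

instance characteristic (n : ℕ) : (permCore K n).Characteristic :=
  Subgroup.characteristic_iff_le_comap.2 fun e _ hx => map_mem e hx

theorem finite_monoidHom (A : Type*) [Group A] [Finite A] [Group.FG K] : Finite (K →* A) := by
  obtain ⟨s, hs⟩ := Group.FG.out (G := K)
  refine Finite.of_injective (fun (f : K →* A) (x : s) => f x) fun f g hfg => ?_
  exact MonoidHom.eq_of_eqOn_dense hs fun x hx => congrFun hfg ⟨x, hx⟩

instance finiteIndex [Group.FG K] (n : ℕ) : (permCore K n).FiniteIndex := by
  have : ∀ m : Fin n, Finite (K →* Equiv.Perm (Fin m)) := fun m => finite_monoidHom _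
  exact Subgroup.finiteIndex_iInf fun p => Subgroup.finiteIndex_ker p.2

theorem eq_one_of_forall_mem [Group.ResiduallyFinite K] {x : K} (h : ∀ n, x ∈ permCore K n) :
    x = 1 := by
  by_contra hx
  obtain ⟨N, hN⟩ := Group.exists_finiteIndexNormalSubgroup_notMem x hx
  -- Apply membership with `n` one more than the order of the quotient, as degrees are strictly
  -- below `n`, to the translation action on `K ⧸ N`.
  have h1 := mem_iff.1 (h _) (Nat.card (K ⧸ N.toSubgroup)) (Nat.lt_succ_self _)
    ((Finite.equivFin (K ⧸ N.toSubgroup)).permCongrHom.toMonoidHom.comp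
      (MulAction.toPermHom K (K ⧸ N.toSubgroup)))
  have h2 : MulAction.toPermHom K (K ⧸ N.toSubgroup) x = 1 :=
    (Finite.equivFin (K ⧸ N.toSubgroup)).permCongrHom.injective (h1.trans (map_one _).symm)
  have h3 := DFunLike.congr_fun h2 ((1 : K) : K ⧸ N.toSubgroup)
  rw [MulAction.toPermHom_apply, MulAction.toPerm_apply, MulAction.Quotient.smul_coe, smul_eq_mul,
    mul_one, Equiv.Perm.one_apply, QuotientGroup.mk_one] at h3
  exact hN ((QuotientGroup.eq_one_iff x).1 h3)

end permCore

/-- The filtration of a group by the characteristic subgroups `permCore` of a normal subgroup of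
finite index. -/
def GroupFiltration.ofNormal {G : Type*} [Group G] [Group.FG G] (K : Subgroup G) [K.Normal]
    [K.FiniteIndex] [Group.ResiduallyFinite K] : GroupFiltration G where
  subgroup n := (permCore K n).map K.subtype
  antitone _ _ h := Subgroup.map_mono (permCore.antitone h)
  normal n := inferInstance
  finiteIndex n := ⟨by
    rw [Subgroup.index_map_subtype]
    exact mul_ne_zero Subgroup.FiniteIndex.index_ne_zero Subgroup.FiniteIndex.index_ne_zero⟩
  iInf_eq_bot := by
    refine (Subgroup.eq_bot_iff_forall _).2 fun x hx => ?_
    rw [Subgroup.mem_iInf] at hx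
    obtain ⟨y, -, rfl⟩ := hx 0
    rw [permCore.eq_one_of_forall_mem (x := y), map_one]
    intro n
    obtain ⟨z, hz, hzy⟩ := hx n
    rwa [← K.subtype_injective hzy]

/-! ### Quasi-isometries of box spaces from commensurability -/

/-- With a transversal `τ` put `ρ g = g * (τ g)⁻¹`. The increment along `s` is `τ g * s * (τ (g *
s))⁻¹`, which takes finitely many values. For `n` in a characteristic `J` it is a conjugate of `n`,
and `J` is normal in `G`. The choice `τ 1 = 1` makes `ρ` the identity on `K`. -/
theorem exists_coarse_retraction {G : Type*} [Group G] (K : Subgroup G) [K.Normal]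
    [K.FiniteIndex] :
    ∃ ρ : G → K, (∀ k : K, ρ k = k) ∧
      (∀ s, (Set.range fun g => (ρ g)⁻¹ * ρ (g * s)).Finite) ∧
      (Set.range fun g => (ρ g : G)⁻¹ * g).Finite ∧
      ∀ J : Subgroup K, J.Characteristic → ∀ n ∈ J.map K.subtype, ∀ g,
        (ρ g)⁻¹ * ρ (g * n) ∈ J := by
  classical
  have hex : ∀ q : G ⧸ K, ∃ t : G, (t : G ⧸ K) = q ∧ (q = 1 → t = 1) := by
    intro q
    by_cases hq : q = 1
    · exact ⟨1, by rw [hq, QuotientGroup.mk_one], fun _ => rfl⟩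
    · obtain ⟨t, ht⟩ := QuotientGroup.mk_surjective q
      exact ⟨t, ht, fun h => (hq h).elim⟩
  choose τ hτ hτ1 using hex
  have hmem : ∀ g : G, g * (τ g)⁻¹ ∈ K := by
    intro g
    rw [← QuotientGroup.eq_one_iff, QuotientGroup.mk_mul, QuotientGroup.mk_inv, hτ,
      mul_inv_cancel]
  have hdiff : ∀ g s : G, (g * (τ g)⁻¹)⁻¹ * (g * s * (τ (g * s : G))⁻¹) =
      τ g * s * (τ (g * s : G))⁻¹ := by
    intro g s
    group
  refine ⟨fun g => ⟨g * (τ g)⁻¹, hmem g⟩, fun k => ?_, fun s => ?_, ?_, fun J hJ n hn g => ?_⟩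
  · apply Subtype.ext
    simp only
    rw [hτ1 _ ((QuotientGroup.eq_one_iff _).2 k.2), inv_one, mul_one]
  · refine Set.Finite.of_finite_image (f := K.subtype) ?_ K.subtype_injective.injOn
    refine (Set.finite_range fun q : G ⧸ K => τ q * s * (τ (q * s))⁻¹).subset ?_
    rintro _ ⟨_, ⟨g, rfl⟩, rfl⟩
    exact ⟨g, (hdiff g s).symm⟩
  · refine (Set.finite_range τ).subset ?_
    rintro _ ⟨g, rfl⟩
    exact ⟨g, by simp only; group⟩
  · have hnK : n ∈ K := by
      obtain ⟨y, -, rfl⟩ := hn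
      exact y.2
    have h1 : ((g * n : G) : G ⧸ K) = g := by
      rw [QuotientGroup.mk_mul, (QuotientGroup.eq_one_iff n).2 hnK, mul_one]
    have h2 : τ g * n * (τ g)⁻¹ ∈ J.map K.subtype :=
      Subgroup.Normal.conj_mem inferInstance n hn _
    have h3 := hdiff g n
    rw [h1] at h3
    rw [← h3] at h2
    obtain ⟨y, hy, hyg⟩ := h2
    suffices hy' : (⟨g * (τ g)⁻¹, hmem g⟩ : K)⁻¹ * ⟨g * n * (τ (g * n : G))⁻¹, hmem _⟩ = y by
      rwa [← hy'] at hy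
    apply Subtype.ext
    refine Eq.trans ?_ hyg.symm
    simp only [Subgroup.coe_mul, Subgroup.coe_inv, h1]

theorem isProperMap_nnreal {f : ℝ≥0 → ℝ≥0} (hf : Continuous f)
    (h : ∀ B, ∃ b, ∀ t, f t ≤ B → t ≤ b) : IsProperMap f := by
  refine isProperMap_iff_isCompact_preimage.2 ⟨hf, fun K hK => ?_⟩
  obtain ⟨B, hB⟩ := hK.bddAbove
  obtain ⟨b, hb⟩ := h B
  exact (isCompact_Icc (a := (0 : ℝ≥0)) (b := b)).of_isClosed_subset
    (hK.isClosed.preimage hf) fun t ht => ⟨zero_le, hb t (hB ht)⟩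

section QuasiIsometry

variable {G H : Type*} [Group G] [Group H] {S : Finset G}
  {hS : Subgroup.closure (S : Set G) = ⊤} {T : Finset H}
  {hT : Subgroup.closure (T : Set H) = ⊤} {N : GroupFiltration G} {M : GroupFiltration H}

open BoxSpace

theorem BoxSpace.coarselyEquivalent_of_natDist_le {φ : BoxSpace S hS N → BoxSpace T hT M}
    {ψ : BoxSpace T hT M → BoxSpace S hS N} {A A' B B' D D' : ℕ}
    (hφ : ∀ x y, natDist (φ x) (φ y) ≤ A * natDist x y + B)
    (hψ : ∀ x y, natDist (ψ x) (ψ y) ≤ A' * natDist x y + B')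
    (hψφ : ∀ x, natDist (ψ (φ x)) x ≤ D) (hφψ : ∀ y, natDist (φ (ψ y)) y ≤ D') :
    CoarselyEquivalent (BoxSpace S hS N) (BoxSpace T hT M) := by
  -- The lower control inverts the affine bound for `ψ`. Adding `1` to the slopes avoids division by
  -- zero and a constant, hence improper, upper control.
  refine ⟨φ, ⟨fun t => (t - (D + B' + D : ℕ)) / (A' + 1), fun t => (A + 1) * t + B, ?_, ?_,
    fun x y => ⟨?_, ?_⟩⟩, D' + 1, by positivity, fun y => ⟨ψ y, ?_⟩⟩
  · refine isProperMap_nnreal (by fun_prop) fun b => ⟨b * (A' + 1) + (D + B' + D : ℕ), ?_⟩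
    intro t ht
    rw [div_le_iff₀ (by positivity)] at ht
    exact tsub_le_iff_right.1 ht
  · refine isProperMap_nnreal (by fun_prop) fun b => ⟨b, fun t ht => le_trans ?_ ht⟩
    rw [add_mul, one_mul]
    exact le_add_right le_add_self
  · rw [div_le_iff₀ (by positivity), tsub_le_iff_right, nndist_eq, nndist_eq]
    have h1 := hψ (φ x) (φ y)
    have h2 := natDist_triangle x (ψ (φ x)) y
    have h3 := natDist_triangle (ψ (φ x)) (ψ (φ y)) y
    have h4 := hψφ x
    have h5 := hψφ y
    rw [natDist_comm x (ψ (φ x))] at h2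
    have : natDist x y ≤ natDist (φ x) (φ y) * (A' + 1) + (D + B' + D) := by
      nlinarith
    exact_mod_cast this
  · rw [nndist_eq, nndist_eq]
    have : natDist (φ x) (φ y) ≤ (A + 1) * natDist x y + B := by
      have := hφ x y
      nlinarith
    simp only
    exact_mod_cast this
  · have : ((natDist (φ (ψ y)) y : ℕ) : ℝ) ≤ D' + 1 := by
      exact_mod_cast (hφψ y).trans (Nat.le_succ _)
    exact this

/-- An index-preserving map that is Lipschitz on components and coarsely surjective is coarsely
Lipschitz. -/
theorem BoxSpace.natDist_map_le {φ : BoxSpace S hS N → BoxSpace T hT M}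
    {ψ : BoxSpace T hT M → BoxSpace S hS N} {A D : ℕ} (hφi : ∀ x, (φ x).index = x.index)
    (hψi : ∀ y, (ψ y).index = y.index)
    (hφ : ∀ x y, x.index = y.index → natDist (φ x) (φ y) ≤ A * natDist x y)
    (hφψ : ∀ y, natDist (φ (ψ y)) y ≤ D) (x y : BoxSpace S hS N) :
    natDist (φ x) (φ y) ≤ A * natDist x y + 4 * D := by
  by_cases hxy : x.index = y.index
  · exact (hφ x y hxy).trans (Nat.le_add_right _ _)
  · have hdiam : ∀ i, (quotientCayley T (M.subgroup i)).diam ≤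
        A * (quotientCayley S (N.subgroup i)).diam + 2 * D := by
      refine fun i => diam_le_of_forall_dist_le fun a b => ?_
      rw [← natDist_same (hS := hT)]
      have h1 := natDist_triangle (⟨i, a⟩ : BoxSpace T hT M) (φ (ψ ⟨i, a⟩)) ⟨i, b⟩
      have h2 := natDist_triangle (φ (ψ ⟨i, a⟩)) (φ (ψ ⟨i, b⟩)) ⟨i, b⟩
      have h3 := hφψ ⟨i, a⟩
      have h4 := hφψ ⟨i, b⟩
      rw [natDist_comm ⟨i, a⟩ (φ (ψ ⟨i, a⟩))] at h1
      have h5 := hφ (ψ ⟨i, a⟩) (ψ ⟨i, b⟩) (by rw [hψi, hψi])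
      have h6 : natDist (ψ ⟨i, a⟩) (ψ ⟨i, b⟩) ≤ (quotientCayley S (N.subgroup i)).diam := by
        have ha := hψi ⟨i, a⟩
        have hb := hψi ⟨i, b⟩
        generalize ψ ⟨i, a⟩ = u at *
        generalize ψ ⟨i, b⟩ = v at *
        obtain ⟨i', u⟩ := u
        obtain ⟨i'', v⟩ := v
        simp only at ha hb
        subst ha hb
        rw [natDist_same]
        exact quotientCayley_dist_le_diam S hS _ u v
      have h7 := Nat.mul_le_mul_left A h6
      omega
    rw [natDist_of_index_ne hxy, natDist_of_index_ne (by rwa [hφi, hφi]), hφi, hφi, mul_add]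
    have h1 := hdiam x.index
    have h2 := hdiam y.index
    omega

/-- The map of box spaces induced by a map of groups. -/
noncomputable def BoxSpace.map (f : G → H) (x : BoxSpace S hS N) : BoxSpace T hT M :=
  ⟨x.index, (f x.point.out : H)⟩

/-- Compatibility with cosets makes the representative chosen by `out` irrelevant. -/
theorem BoxSpace.map_mk {f : G → H}
    (hf : ∀ i, ∀ n ∈ N.subgroup i, ∀ g, (f g)⁻¹ * f (g * n) ∈ M.subgroup i) (i : ℕ) (g : G) :
    (BoxSpace.map f (⟨i, g⟩ : BoxSpace S hS N) : BoxSpace T hT M) = ⟨i, (f g : H)⟩ := by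
  obtain ⟨n, hn⟩ := QuotientGroup.mk_out_eq_mul (N.subgroup i) g
  have h1 := QuotientGroup.eq.2 (hf i n n.2 g)
  rw [← hn] at h1
  simp only [BoxSpace.map]
  rw [h1]

theorem BoxSpace.natDist_map_le_mul {f : G → H}
    (hf : ∀ i, ∀ n ∈ N.subgroup i, ∀ g, (f g)⁻¹ * f (g * n) ∈ M.subgroup i) {A : ℕ}
    (hA : ∀ g, ∀ s ∈ (S : Set G), (f g)⁻¹ * f (g * s) ∈ wordBall (T : Set H) A)
    (x y : BoxSpace S hS N) (hxy : x.index = y.index) :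
    natDist (BoxSpace.map f x : BoxSpace T hT M) (BoxSpace.map f y) ≤ A * natDist x y := by
  obtain ⟨i, a⟩ := x
  obtain ⟨j, b⟩ := y
  simp only at hxy
  subst hxy
  rw [natDist_same, BoxSpace.map, BoxSpace.map, natDist_same, quotientCayley_dist_le_iff hT]
  refine wordBall.lipschitz (f := fun q : G ⧸ N.subgroup i => (f q.out : H ⧸ M.subgroup i))
    (wordBall.lipschitz_one ?_) _ ((quotientCayley_dist_le_iff hS).1 le_rfl)
  rintro q _ ⟨s, hs, rfl⟩
  obtain ⟨g, rfl⟩ := QuotientGroup.mk_surjective q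
  have key : ∀ g : G, (f (g : G ⧸ N.subgroup i).out : H ⧸ M.subgroup i) = f g := by
    intro g
    obtain ⟨n, hn⟩ := QuotientGroup.mk_out_eq_mul (N.subgroup i) g
    rw [hn]
    exact (QuotientGroup.eq.2 (hf i n n.2 g)).symm
  rw [QuotientGroup.mk'_apply, ← QuotientGroup.mk_mul, key, key]
  exact wordBall.map_mem (QuotientGroup.mk' (M.subgroup i)) (hA g s hs)

theorem BoxSpace.natDist_map_map_le {f : G → H} {h : H → G}
    (hf : ∀ i, ∀ n ∈ N.subgroup i, ∀ g, (f g)⁻¹ * f (g * n) ∈ M.subgroup i)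
    (hh : ∀ i, ∀ n ∈ M.subgroup i, ∀ g, (h g)⁻¹ * h (g * n) ∈ N.subgroup i) {D : ℕ}
    (hD : ∀ g, (h (f g))⁻¹ * g ∈ wordBall (S : Set G) D) (x : BoxSpace S hS N) :
    natDist (BoxSpace.map h (BoxSpace.map f x : BoxSpace T hT M)) x ≤ D := by
  obtain ⟨i, q⟩ := x
  obtain ⟨g, rfl⟩ := QuotientGroup.mk_surjective q
  rw [BoxSpace.map_mk hf, BoxSpace.map_mk hh, natDist_same, quotientCayley_dist_le_iff hS]
  exact wordBall.map_mem (QuotientGroup.mk' (N.subgroup i)) (hD g)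

end QuasiIsometry

theorem exists_forall_mem_wordBall {G K Q : Type*} [Group G] [Group K] [Group Q] {S : Set G}
    (hS : S.Finite) {T : Set Q} (hT : Subgroup.closure T = ⊤) {ρ : G → K}
    (hρ : ∀ s, (Set.range fun g => (ρ g)⁻¹ * ρ (g * s)).Finite) (e : K →* Q) :
    ∃ A, ∀ g, ∀ s ∈ S, (e (ρ g))⁻¹ * e (ρ (g * s)) ∈ wordBall T A := by
  obtain ⟨A, hA⟩ := wordBall.exists_subset hT ((hS.biUnion fun s _ => hρ s).image e)
  refine ⟨A, fun g s hs => hA ⟨_, Set.mem_biUnion hs ⟨g, rfl⟩, ?_⟩⟩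
  rw [map_mul, map_inv]

/-- The maps `e ∘ ρ` and `e.symm ∘ σ` are coarsely inverse: `σ` fixes `L`, so one composite is `ρ`,
at bounded distance from the identity; symmetrically the other is `σ`. -/
theorem CommensurableViaNormal.exists_coarselyEquivalent {G H : Type*} [Group G] [Group H]
    [Group.ResiduallyFinite G] {S : Finset G} (hS : Subgroup.closure (S : Set G) = ⊤)
    {T : Finset H} (hT : Subgroup.closure (T : Set H) = ⊤) (h : CommensurableViaNormal G H) :
    ∃ (N : GroupFiltration G) (M : GroupFiltration H),
      CoarselyEquivalent (BoxSpace S hS N) (BoxSpace T hT M) := by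
  obtain ⟨K, L, _, _, _, _, ⟨e⟩⟩ := h
  have : Group.FG G := ⟨⟨S, hS⟩⟩
  have : Group.FG H := ⟨⟨T, hT⟩⟩
  -- Residual finiteness passes from `G` to `K` and across `e` to `L`.
  have : Group.ResiduallyFinite L := by
    rw [Group.residuallyFinite_iff_exists_finiteIndexNormalSubgroup]
    intro x hx
    obtain ⟨N, hN⟩ := Group.exists_finiteIndexNormalSubgroup_notMem (e.symm x) (by simpa using hx)
    exact ⟨N.comap e.symm.toMonoidHom, hN⟩
  obtain ⟨ρ, hρ, hρS, hρd, hρJ⟩ := exists_coarse_retraction K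
  obtain ⟨σ, hσ, hσT, hσd, hσJ⟩ := exists_coarse_retraction L
  obtain ⟨A, hA⟩ := exists_forall_mem_wordBall S.finite_toSet hT hρS
    (L.subtype.comp e.toMonoidHom)
  obtain ⟨B, hB⟩ := exists_forall_mem_wordBall T.finite_toSet hS hσT
    (K.subtype.comp e.symm.toMonoidHom)
  obtain ⟨D, hD⟩ := wordBall.exists_subset hS hρd
  obtain ⟨D', hD'⟩ := wordBall.exists_subset hT hσd
  let f : G → H := fun g => e (ρ g)
  let h : H → G := fun x => e.symm (σ x)
  have hf : ∀ i, ∀ n ∈ (GroupFiltration.ofNormal K).subgroup i, ∀ g,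
      (f g)⁻¹ * f (g * n) ∈ (GroupFiltration.ofNormal L).subgroup i := by
    intro i n hn g
    exact ⟨_, permCore.map_mem e (hρJ _ inferInstance n hn g), by simp [f]⟩
  have hh : ∀ i, ∀ n ∈ (GroupFiltration.ofNormal L).subgroup i, ∀ g,
      (h g)⁻¹ * h (g * n) ∈ (GroupFiltration.ofNormal K).subgroup i := by
    intro i n hn g
    exact ⟨_, permCore.map_mem e.symm (hσJ _ inferInstance n hn g), by simp [h]⟩
  have hhf : ∀ g, (h (f g))⁻¹ * g ∈ wordBall (S : Set G) D := fun g => hD ⟨g, by simp [h, f, hσ]⟩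
  have hfh : ∀ x, (f (h x))⁻¹ * x ∈ wordBall (T : Set H) D' := fun x =>
    hD' ⟨x, by simp [h, f, hρ]⟩
  have h1 := BoxSpace.natDist_map_map_le (hS := hS) (hT := hT) hf hh hhf
  have h2 := BoxSpace.natDist_map_map_le (hS := hT) (hT := hS) hh hf hfh
  exact ⟨GroupFiltration.ofNormal K, GroupFiltration.ofNormal L,
    BoxSpace.coarselyEquivalent_of_natDist_le
      (BoxSpace.natDist_map_le (fun _ => rfl) (fun _ => rfl)
        (BoxSpace.natDist_map_le_mul hf hA) h2)
      (BoxSpace.natDist_map_le (fun _ => rfl) (fun _ => rfl)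
        (BoxSpace.natDist_map_le_mul hh hB) h1) h1 h2⟩

theorem theorem1p4 {G H : Type*} [Group G] [Group H]
    [Group.IsFinitelyPresented G] [Group.ResiduallyFinite G] [Group.FG H]
    (S : Finset G) (hS : Subgroup.closure (S : Set G) = ⊤)
    (T : Finset H) (hT : Subgroup.closure (T : Set H) = ⊤) :
    (∃ (N : GroupFiltration G) (M : GroupFiltration H),
      CoarselyEquivalent (BoxSpace S hS N) (BoxSpace T hT M)) ↔
    CommensurableViaNormal G H :=
  ⟨fun ⟨_, _, h⟩ => h.commensurableViaNormal, fun h => h.exists_coarselyEquivalent hS hT⟩
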